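/- Let $n\ge 1$, let $X=\{1,\dots,n\}$, and let $\mathbb{CL}(n)$ be the Clifford group, i.e. the group with generators $\varepsilon,\gamma_1,\dots,\gamma_n$ and relations $\varepsilon^2=1$, $\gamma_i^2=1$, $\gamma_i\gamma_j=\varepsilon\gamma_j\gamma_i$ for $i\neq j$ (and, for $n=1$, also $\varepsilon\gamma_1=\gamma_1\varepsilon$). Equivalently, $\mathbb{CL}(n)=\{\pm\gamma_A : A\subseteq X\}$ with multiplication $$\varepsilon_1\gamma_A\cdot\varepsilon_2\gamma_B=\varepsilon_1\varepsilon_2(-1)^{\xi(A,B)}\gamma_{A\triangle B},\qquad \xi(A,B)=|\{(a,b)\in A\times B: a>b\}|,\quad \varepsilon_1,\varepsilon_2\in\{1,-1\}.$$ Let $\tau$ be the involutive anti-automorphism of $\mathbb{CL}(n)$ given by $\tau(\varepsilon\gamma_A)=\varepsilon(-1)^{|A|(|A|+1)/2}\gamma_A$ for $\varepsilon=\pm1$ and $A\subseteq X$ if $n\equiv 3 \pmod 4$, and by $\tau(g)=g^{-1}$ otherwise. For a finite-dimensional complex representation $(\rho,V)$ of a finite group $G$ with an involutive anti-automorphism $\tau$,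 let $\rho^\tau$ be the representation of $G$ on the dual space $V'$ given by $[\rho^\tau(g)f](v)=f(\rho(\tau(g))v)$. The group $G$ is called $\tau$-simply reducible if (i) for all irreducible representations $\rho_1,\rho_2$ of $G$, the tensor product $\rho_1\otimes\rho_2$ is multiplicity-free, that is, a direct sum of pairwise inequivalent irreducible representations, and (ii) $\rho^\tau$ is equivalent to $\rho$ for every irreducible representation $\rho$ of $G$. **Theorem.** The group $\mathbb{CL}(n)$ is $\tau$-simply reducible. -/

import Mathlib

universe u v

/-! ## Involutive anti-automorphisms and τ-simple reducibility -/

/-- An involutive anti-automorphism of a group `G`: a map `τ : G → G` with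
`τ (g * h) = τ h * τ g` and `τ (τ g) = g` (it is then automatically bijective). -/
structure InvolutiveAntiAut (G : Type*) [Group G] where
  toFun : G → G
  map_mul' : ∀ g h : G, toFun (g * h) = toFun h * toFun g
  involutive' : ∀ g : G, toFun (toFun g) = g

namespace InvolutiveAntiAut

variable {G : Type*} [Group G]

instance : CoeFun (InvolutiveAntiAut G) (fun _ => G → G) := ⟨toFun⟩

theorem map_mul (τ : InvolutiveAntiAut G) (g h : G) : τ (g * h) = τ h * τ g := τ.map_mul' g h

theorem map_one (τ : InvolutiveAntiAut G) : τ 1 = 1 := by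
  have h := τ.map_mul 1 1
  rw [one_mul] at h
  exact left_eq_mul.mp h

/-- The inversion `g ↦ g⁻¹`. -/
def inversion (G : Type*) [Group G] : InvolutiveAntiAut G where
  toFun g := g⁻¹
  map_mul' := mul_inv_rev
  involutive' := inv_inv

end InvolutiveAntiAut

/-- The `τ`-conjugate of a complex representation `(ρ, V)`: the representation on the dual space
given by `(ρ^τ(g) f)(v) = f (ρ(τ(g)) v)`. -/
def tauConjugate {G : Type*} [Group G] (τ : InvolutiveAntiAut G) {V : Type*} [AddCommGroup V]
    [Module ℂ V] (ρ : Representation ℂ G V) : Representation ℂ G (Module.Dual ℂ V) where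
  toFun g := Module.Dual.transpose (R := ℂ) (ρ (τ g))
  map_one' := by
    ext f v
    simp [τ.map_one, Module.Dual.transpose_apply]
  map_mul' g h := by
    ext f v
    simp [τ.map_mul, Module.Dual.transpose_apply]

/-- A representation is multiplicity-free if it is the (internal) direct sum of finitely many
irreducible subrepresentations that are pairwise inequivalent. -/
def IsMultiplicityFree {G : Type*} [Group G] {V : Type*} [AddCommGroup V] [Module ℂ V]
    (ρ : Representation ℂ G V) : Prop :=
  ∃ (m : ℕ) (U : Fin m → Subrepresentation ρ),
    DirectSum.IsInternal (fun i => (U i).toSubmodule) ∧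
    (∀ i, (U i).toRepresentation.IsIrreducible) ∧
    ∀ i j, i ≠ j → IsEmpty ((U i).toRepresentation.Equiv (U j).toRepresentation)

/-- A (finite) group `G` is `τ`-simply reducible if the tensor product of any two irreducible
(finite-dimensional, complex) representations is multiplicity-free and every irreducible
representation is equivalent to its `τ`-conjugate. -/
def IsTauSimplyReducible (G : Type v) [Group G] (τ : InvolutiveAntiAut G) : Prop :=
  (∀ (V W : Type u) [AddCommGroup V] [Module ℂ V] [FiniteDimensional ℂ V]
      [AddCommGroup W] [Module ℂ W] [FiniteDimensional ℂ W]
      (ρ : Representation ℂ G V) (σ : Representation ℂ G W),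
      ρ.IsIrreducible → σ.IsIrreducible → IsMultiplicityFree (ρ.tprod σ)) ∧
  (∀ (V : Type u) [AddCommGroup V] [Module ℂ V] [FiniteDimensional ℂ V]
      (ρ : Representation ℂ G V), ρ.IsIrreducible →
      Nonempty ((tauConjugate τ ρ).Equiv ρ))

/-! ## The Clifford groups -/

/-- The underlying set `{ε γ_A : ε = ±1, A ⊆ {1, …, n}}` of the Clifford group `CL(n)`; the
element `ε γ_A` is `⟨ε, A⟩`, and the index set `{1, …, n}` is represented by `Fin n`. -/
@[ext]
structure CliffordGroup (n : ℕ) where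
  sign : ℤˣ
  supp : Finset (Fin n)

namespace CliffordGroup

variable {n : ℕ}

/-- `ξ(A, B)`: the number of pairs `(a, b) ∈ A × B` with `a > b`. -/
def xi (A B : Finset (Fin n)) : ℕ := ((A ×ˢ B).filter (fun p => p.2 < p.1)).card

theorem xi_eq_sum (A B : Finset (Fin n)) :
    xi A B = ∑ a ∈ A, ∑ b ∈ B, if b < a then 1 else 0 := by
  rw [xi, Finset.card_filter, Finset.sum_product]

theorem neg_one_pow_xi (A B : Finset (Fin n)) :
    (-1 : ℤˣ) ^ xi A B = ∏ a ∈ A, ∏ b ∈ B, if b < a then (-1 : ℤˣ) else 1 := by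
  simp_rw [xi_eq_sum, ← Finset.prod_pow_eq_pow_sum, pow_ite, pow_one, pow_zero]

theorem prod_symmDiff_units (A B : Finset (Fin n)) (f : Fin n → ℤˣ) :
    ∏ a ∈ symmDiff A B, f a = (∏ a ∈ A, f a) * ∏ a ∈ B, f a := by
  have h (C : Finset (Fin n)) : ∏ a ∈ C, f a = ∏ a, if a ∈ C then f a else 1 := by
    simp [Finset.prod_ite_mem]
  rw [h, h A, h B, ← Finset.prod_mul_distrib]
  refine Finset.prod_congr rfl fun a _ => ?_
  by_cases hA : a ∈ A <;> by_cases hB : a ∈ B <;> simp [Finset.mem_symmDiff, hA, hB]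

theorem xi_symmDiff_left (A B C : Finset (Fin n)) :
    (-1 : ℤˣ) ^ xi (symmDiff A B) C = (-1) ^ xi A C * (-1) ^ xi B C := by
  simp_rw [neg_one_pow_xi, prod_symmDiff_units]

theorem xi_symmDiff_right (A B C : Finset (Fin n)) :
    (-1 : ℤˣ) ^ xi A (symmDiff B C) = (-1) ^ xi A B * (-1) ^ xi A C := by
  simp_rw [neg_one_pow_xi, prod_symmDiff_units, Finset.prod_mul_distrib]

/-- `ε₁ γ_A · ε₂ γ_B = ε₁ ε₂ (-1)^{ξ(A,B)} γ_{A △ B}`. -/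
instance : Mul (CliffordGroup n) :=
  ⟨fun x y => ⟨x.sign * y.sign * (-1) ^ xi x.supp y.supp, symmDiff x.supp y.supp⟩⟩

instance : One (CliffordGroup n) := ⟨⟨1, ∅⟩⟩

instance : Inv (CliffordGroup n) := ⟨fun x => ⟨x.sign * (-1) ^ xi x.supp x.supp, x.supp⟩⟩

theorem mul_def (x y : CliffordGroup n) :
    x * y = ⟨x.sign * y.sign * (-1) ^ xi x.supp y.supp, symmDiff x.supp y.supp⟩ := rfl

theorem one_def : (1 : CliffordGroup n) = ⟨1, ∅⟩ := rfl

theorem inv_def (x : CliffordGroup n) :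
    x⁻¹ = ⟨x.sign * (-1) ^ xi x.supp x.supp, x.supp⟩ := rfl

instance : Group (CliffordGroup n) :=
  Group.ofLeftAxioms
    (fun x y z => by
      ext1
      · simp only [mul_def, xi_symmDiff_left, xi_symmDiff_right]
        simp only [mul_comm, mul_left_comm, mul_assoc]
      · simp only [mul_def, symmDiff_assoc])
    (fun x => by
      ext1 <;> simp [mul_def, one_def, xi])
    (fun x => by
      ext1
      · rw [mul_def, inv_def, one_def]
        rcases Int.units_eq_one_or x.sign with h | h <;>
          rcases Int.units_eq_one_or ((-1) ^ xi x.supp x.supp) with h' | h' <;> simp [h, h']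
      · simp [mul_def, inv_def, one_def])

instance : Finite (CliffordGroup n) :=
  Finite.of_injective (fun x : CliffordGroup n => (x.sign, x.supp)) fun x y h => by
    simp only [Prod.mk.injEq] at h
    exact CliffordGroup.ext h.1 h.2

/-- `ξ(A, A) = |A| (|A| - 1) / 2`. -/
theorem xi_self (A : Finset (Fin n)) : xi A A = A.card * (A.card - 1) / 2 := by
  induction A using Finset.induction_on_max with
  | empty => simp [xi]
  | insert a s hs ih =>
    have ha : a ∉ s := fun h => lt_irrefl _ (hs a h)
    have h1 : ∀ b ∈ s, ¬ a < b := fun b hb => (hs b hb).not_gt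
    have h2 : xi (insert a s) (insert a s) = s.card + xi s s := by
      rw [xi_eq_sum, xi_eq_sum, Finset.sum_insert ha, Finset.sum_insert ha, if_neg (lt_irrefl a),
        zero_add, Finset.sum_congr rfl (fun b hb => if_pos (hs b hb)), Finset.card_eq_sum_ones]
      congr 1
      refine Finset.sum_congr rfl fun b hb => ?_
      rw [Finset.sum_insert ha, if_neg (h1 b hb), zero_add]
    rw [h2, ih, Finset.card_insert_of_notMem ha, Nat.triangle_succ, add_comm]

theorem neg_one_pow_triangle (A : Finset (Fin n)) :
    (-1 : ℤˣ) ^ (A.card * (A.card + 1) / 2) = (-1) ^ xi A A * (-1) ^ A.card := by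
  rw [xi_self, ← pow_add, mul_comm A.card (A.card + 1), ← Nat.triangle_succ, Nat.add_sub_cancel]

theorem neg_one_pow_card_symmDiff (A B : Finset (Fin n)) :
    (-1 : ℤˣ) ^ (symmDiff A B).card = (-1) ^ A.card * (-1) ^ B.card := by
  simpa using prod_symmDiff_units A B (fun _ => -1)

/-- The involutive anti-automorphism `τ'(ε γ_A) = ε (-1)^{|A|(|A|+1)/2} γ_A` of `CL(n)`. -/
def tauPrime (n : ℕ) : InvolutiveAntiAut (CliffordGroup n) where
  toFun x := ⟨x.sign * (-1) ^ (x.supp.card * (x.supp.card + 1) / 2), x.supp⟩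
  map_mul' x y := by
    ext1
    · simp only [mul_def, neg_one_pow_triangle, neg_one_pow_card_symmDiff, xi_symmDiff_left,
        xi_symmDiff_right]
      rcases Int.units_eq_one_or ((-1) ^ xi x.supp y.supp) with h | h <;>
        simp only [h, mul_one, one_mul, mul_neg, neg_mul, neg_neg] <;>
        simp only [mul_comm, mul_left_comm, mul_assoc]
    · simp only [mul_def, symmDiff_comm]
  involutive' x := by
    ext1
    · rcases Int.units_eq_one_or ((-1 : ℤˣ) ^ (x.supp.card * (x.supp.card + 1) / 2)) with h | h <;>
        simp [h]
    · rfl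

/-- The involutive anti-automorphism `τ` of `CL(n)`: it is `τ'` if `n ≡ 3 (mod 4)`, and the
inversion otherwise. -/
def tau (n : ℕ) : InvolutiveAntiAut (CliffordGroup n) :=
  if n % 4 = 3 then tauPrime n else InvolutiveAntiAut.inversion (CliffordGroup n)

/-! ### `CL(n)` is the group presented by the Clifford relations -/

/-- The generators `ε, γ_1, …, γ_n`. -/
inductive Gen (n : ℕ) where
  | eps : Gen n
  | gam : Fin n → Gen n

/-- The Clifford relations `ε² = 1`, `γ_i² = 1`, `γ_i γ_j = ε γ_j γ_i` for `i ≠ j`, and, for `n = 1`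
only, `ε γ_1 = γ_1 ε`. -/
inductive Rel (n : ℕ) : FreeGroup (Gen n) → Prop where
  | eps_sq : Rel n (FreeGroup.of .eps ^ 2)
  | gam_sq (i : Fin n) : Rel n (FreeGroup.of (.gam i) ^ 2)
  | gam_gam (i j : Fin n) (h : i ≠ j) :
      Rel n (FreeGroup.of (.gam i) * FreeGroup.of (.gam j) *
        (FreeGroup.of .eps * FreeGroup.of (.gam j) * FreeGroup.of (.gam i))⁻¹)
  | eps_gam (h : n = 1) (i : Fin n) :
      Rel n (FreeGroup.of .eps * FreeGroup.of (.gam i) *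
        (FreeGroup.of (.gam i) * FreeGroup.of .eps)⁻¹)

/-- The images of the generators: `ε ↦ -γ_∅` and `γ_i ↦ γ_{i}`. -/
def genImage : Gen n → CliffordGroup n
  | .eps => ⟨-1, ∅⟩
  | .gam i => ⟨1, {i}⟩

theorem empty_symmDiff' (A : Finset (Fin n)) : symmDiff ∅ A = A := bot_symmDiff A

theorem symmDiff_empty' (A : Finset (Fin n)) : symmDiff A ∅ = A := symmDiff_bot A

theorem lift_rel (r : FreeGroup (Gen n)) (hr : r ∈ {r | Rel n r}) :
    FreeGroup.lift genImage r = 1 := by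
  rcases hr with _ | i | ⟨i, j, h⟩ | ⟨h, i⟩
  · simp [genImage, pow_two, mul_def, one_def, xi]
  · simp [genImage, pow_two, mul_def, one_def, xi, Finset.filter_singleton]
  · simp only [map_mul, map_inv, FreeGroup.lift_apply_of, genImage]
    rw [mul_inv_eq_one]
    rcases lt_or_gt_of_ne h with h | h <;>
      simp [mul_def, xi, Finset.filter_singleton, h, h.not_gt, symmDiff_comm, empty_symmDiff']
  · simp only [map_mul, map_inv, FreeGroup.lift_apply_of, genImage]
    rw [mul_inv_eq_one]
    simp [mul_def, xi, empty_symmDiff', symmDiff_empty']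

/-- The group with generators `ε, γ_1, …, γ_n` and the Clifford relations. -/
abbrev Presented (n : ℕ) := PresentedGroup {r | Rel n r}

/-- The homomorphism from the presented group to `CL(n)` given on generators by `genImage`. -/
def ofPresented (n : ℕ) : Presented n →* CliffordGroup n := PresentedGroup.toGroup lift_rel

namespace Presented

/-- The generator `ε` of the presented group. -/
def e : Presented n := PresentedGroup.of .eps

/-- The generator `γ_i` of the presented group. -/
def g (i : Fin n) : Presented n := PresentedGroup.of (.gam i)

theorem e_mul_e : (e : Presented n) * e = 1 := by
  have h := PresentedGroup.one_of_mem (rels := {r | Rel n r}) Rel.eps_sq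
  rwa [pow_two, map_mul] at h

theorem g_mul_g (i : Fin n) : g i * g i = 1 := by
  have h := PresentedGroup.one_of_mem (rels := {r | Rel n r}) (Rel.gam_sq i)
  rwa [pow_two, map_mul] at h

theorem g_mul_g_of_ne {i j : Fin n} (hij : i ≠ j) : g i * g j = e * g j * g i := by
  have h := PresentedGroup.one_of_mem (rels := {r | Rel n r}) (Rel.gam_gam i j hij)
  rw [map_mul, map_inv, mul_inv_eq_one, map_mul, map_mul, map_mul] at h
  exact h

theorem e_mul_g (i : Fin n) : e * g i = g i * e := by
  by_cases hn : n = 1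
  · have h := PresentedGroup.one_of_mem (rels := {r | Rel n r}) (Rel.eps_gam hn i)
    rw [map_mul, map_inv, mul_inv_eq_one, map_mul, map_mul] at h
    exact h
  · have : Nontrivial (Fin n) := Fin.nontrivial_iff_two_le.mpr (by have := i.pos; omega)
    obtain ⟨j, hj⟩ := exists_ne i
    have h1 := g_mul_g_of_ne hj
    have h2 := g_mul_g_of_ne hj.symm
    have he1 : e = g j * g i * g j * g i := by
      rw [h1, mul_assoc (e * g i), g_mul_g, mul_one, mul_assoc, g_mul_g, mul_one]
    have he2 : e = g i * g j * g i * g j := by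
      rw [h2, mul_assoc (e * g j), g_mul_g, mul_one, mul_assoc, g_mul_g, mul_one]
    calc e * g i = g j * g i * g j * g i * g i := by rw [← he1]
      _ = g i * g i * (g j * g i * g j) := by
        rw [mul_assoc _ (g i) (g i), g_mul_g, mul_one, one_mul]
      _ = g i * (g i * g j * g i * g j) := by simp only [mul_assoc]
      _ = g i * e := by rw [← he2]

/-- The image of a sign. -/
def sgn (s : ℤˣ) : Presented n := if s = 1 then 1 else e

theorem sgn_one : (sgn 1 : Presented n) = 1 := if_pos rfl

theorem sgn_neg_one : (sgn (-1) : Presented n) = e := if_neg (by decide)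

theorem sgn_mul (s t : ℤˣ) : (sgn (s * t) : Presented n) = sgn s * sgn t := by
  rcases Int.units_eq_one_or s with rfl | rfl <;> rcases Int.units_eq_one_or t with rfl | rfl <;>
    simp [sgn_one, sgn_neg_one, e_mul_e]

theorem sgn_mul_g (s : ℤˣ) (i : Fin n) : sgn s * g i = g i * sgn s := by
  rcases Int.units_eq_one_or s with rfl | rfl
  · simp [sgn_one]
  · rw [sgn_neg_one, e_mul_g]

/-- The product of the `γ_a`, `a ∈ A`, in increasing order. -/
def word (A : Finset (Fin n)) : Presented n := (A.sort.map g).prod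

theorem word_insert {a : Fin n} {s : Finset (Fin n)} (h : ∀ b ∈ s, a < b) :
    word (insert a s) = g a * word s := by
  rw [word, Finset.sort_insert _ (fun b hb => (h b hb).le) (fun ha => lt_irrefl _ (h a ha)),
    List.map_cons, List.prod_cons, word]

theorem g_mul_word (i : Fin n) (A : Finset (Fin n)) :
    g i * word A = sgn ((-1) ^ xi {i} A) * word (symmDiff {i} A) := by
  induction A using Finset.induction_on_min with
  | empty => simp [xi, symmDiff_empty', sgn_one, word]
  | insert a s hs ih =>
    have ha : a ∉ s := fun h => lt_irrefl _ (hs a h)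
    have hxi : xi {i} (insert a s) = (if a < i then 1 else 0) + xi {i} s := by
      simp_rw [xi_eq_sum, Finset.sum_singleton, Finset.sum_insert ha]
    have hxi0 (h : i ≤ a) : xi {i} (insert a s) = 0 := by
      rw [hxi, if_neg h.not_gt, zero_add, xi_eq_sum, Finset.sum_singleton]
      exact Finset.sum_eq_zero fun b hb => if_neg (h.trans (hs b hb).le).not_gt
    rcases lt_trichotomy i a with h | rfl | h
    · have hlt : ∀ b ∈ insert a s, i < b := by
        intro b hb
        rcases Finset.mem_insert.mp hb with rfl | hb
        exacts [h, h.trans (hs b hb)]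
      have hd : symmDiff {i} (insert a s) = insert i (insert a s) := by
        have : i ∉ insert a s := fun hi => lt_irrefl _ (hlt i hi)
        ext x
        by_cases hx : x = i
        · subst hx; simp [Finset.mem_symmDiff, this]
        · simp [Finset.mem_symmDiff, hx]
      rw [hxi0 h.le, pow_zero, sgn_one, one_mul, hd, word_insert hlt]
    · have hd : symmDiff {i} (insert i s) = s := by
        ext x
        by_cases hx : x = i
        · subst hx; simp [Finset.mem_symmDiff, ha]
        · simp [Finset.mem_symmDiff, hx]
      rw [hxi0 le_rfl, pow_zero, sgn_one, one_mul, hd, word_insert hs, ← mul_assoc, g_mul_g,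
        one_mul]
    · have hd : symmDiff {i} (insert a s) = insert a (symmDiff {i} s) := by
        ext x
        by_cases hx : x = a
        · subst hx; simp [Finset.mem_symmDiff, h.ne]
        · simp [Finset.mem_symmDiff, hx]
      have hlt : ∀ b ∈ symmDiff {i} s, a < b := by
        intro b hb
        rcases Finset.mem_symmDiff.mp hb with hb | hb
        · rw [Finset.mem_singleton.mp hb.1]; exact h
        · exact hs b hb.1
      rw [hd, word_insert hlt, word_insert hs, hxi, if_pos h, pow_add, pow_one, sgn_mul,
        sgn_neg_one, ← mul_assoc, g_mul_g_of_ne h.ne', mul_assoc, ih, mul_assoc e, mul_assoc e,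
        ← mul_assoc (g a), ← sgn_mul_g, mul_assoc]

/-- The normal form `± γ_{a_1} ⋯ γ_{a_k}`, `a_1 < ⋯ < a_k`, of an element of `CL(n)`. -/
def normalForm (x : CliffordGroup n) : Presented n := sgn x.sign * word x.supp

theorem ofPresented_e : ofPresented n e = ⟨-1, ∅⟩ := PresentedGroup.toGroup.of _

theorem ofPresented_g (i : Fin n) : ofPresented n (g i) = ⟨1, {i}⟩ := PresentedGroup.toGroup.of _

theorem ofPresented_sgn (s : ℤˣ) : ofPresented n (sgn s) = ⟨s, ∅⟩ := by
  rcases Int.units_eq_one_or s with rfl | rfl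
  · rw [sgn_one, _root_.map_one, one_def]
  · rw [sgn_neg_one, ofPresented_e]

theorem normalForm_e_mul (x : CliffordGroup n) :
    normalForm (⟨-1, ∅⟩ * x) = e * normalForm x := by
  simp only [normalForm, mul_def, empty_symmDiff', sgn_mul, sgn_neg_one]
  simp [xi, sgn_one, mul_assoc]

theorem normalForm_g_mul (i : Fin n) (x : CliffordGroup n) :
    normalForm (⟨1, {i}⟩ * x) = g i * normalForm x := by
  simp only [normalForm, mul_def, one_mul, sgn_mul]
  rw [mul_assoc, ← g_mul_word, ← mul_assoc, ← mul_assoc, sgn_mul_g]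

theorem normalForm_ofPresented_mul (y : Presented n) (x : CliffordGroup n) :
    normalForm (ofPresented n y * x) = y * normalForm x := by
  suffices h : ∀ y : Presented n, y ∈ Subgroup.closure (Set.range (PresentedGroup.of)) →
      ∀ x, normalForm (ofPresented n y * x) = y * normalForm x from
    h y (by rw [PresentedGroup.closure_range_of]; trivial) x
  intro y hy
  induction hy using Subgroup.closure_induction with
  | mem y hy =>
    obtain ⟨a, rfl⟩ := hy
    rcases a with _ | i
    · intro x; exact (congrArg (fun z => normalForm (z * x)) ofPresented_e).trans (normalForm_e_mul x)
    · intro x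
      exact (congrArg (fun z => normalForm (z * x)) (ofPresented_g i)).trans (normalForm_g_mul i x)
  | one => intro x; simp
  | mul y z _ _ hy hz => intro x; rw [_root_.map_mul, mul_assoc, hy, hz, mul_assoc]
  | inv y _ hy =>
    intro x
    rw [eq_inv_mul_iff_mul_eq, ← hy, map_inv, mul_inv_cancel_left]

theorem normalForm_one : normalForm (1 : CliffordGroup n) = 1 := by
  simp [normalForm, one_def, sgn_one, word]

theorem normalForm_ofPresented (y : Presented n) : normalForm (ofPresented n y) = y := by
  have h := normalForm_ofPresented_mul y 1
  rwa [mul_one, normalForm_one, mul_one] at h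

theorem ofPresented_word (A : Finset (Fin n)) : ofPresented n (word A) = ⟨1, A⟩ := by
  induction A using Finset.induction_on_min with
  | empty => simp [word, one_def]
  | insert a s hs ih =>
    have ha : a ∉ s := fun h => lt_irrefl _ (hs a h)
    have hd : symmDiff {a} s = insert a s := by
      ext x
      by_cases hx : x = a
      · subst hx; simp [Finset.mem_symmDiff, ha]
      · simp [Finset.mem_symmDiff, hx]
    have hx : xi {a} s = 0 := by
      rw [xi_eq_sum, Finset.sum_singleton]
      exact Finset.sum_eq_zero fun b hb => if_neg (hs b hb).not_gt
    rw [word_insert hs, _root_.map_mul, ih, ofPresented_g, mul_def]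
    simp [hd, hx]

theorem ofPresented_normalForm (x : CliffordGroup n) : ofPresented n (normalForm x) = x := by
  rw [normalForm, _root_.map_mul, ofPresented_sgn, ofPresented_word, mul_def]
  ext1 <;> simp [xi, empty_symmDiff']

end Presented

/-- `CL(n)` is presented by the generators `ε, γ_1, …, γ_n` and the Clifford relations; under this
isomorphism `γ_A` is the product of the `γ_a`, `a ∈ A`, in increasing order. -/
def presentation (n : ℕ) : Presented n ≃* CliffordGroup n where
  __ := ofPresented n
  invFun := Presented.normalForm
  left_inv := Presented.normalForm_ofPresented
  right_inv := Presented.ofPresented_normalForm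

end CliffordGroup

/-! ## Irreducible representations of finite groups -/

namespace Representation

/-! ### Irreducibility under equivalences, duals and one-dimensional twists. -/

section Field

variable {k G V W : Type*} [Field k] [Group G] [AddCommGroup V] [Module k V]
  [AddCommGroup W] [Module k W]

/-! Everything follows from two facts, with no classification of the irreducibles: `ε` is central
with `ε² = 1`, and every commutator is `1` or `ε`. By Schur, `ε` acts as `1` or `-1` on an
irreducible. If as `1`, all operators commute and the dimension is one (`finrank_eq_one_of_eps`). If
as `-1`, a noncentral `x` is conjugate to `εx`, so the character vanishes off the centre
(`character_eq_zero_of_not_central`).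

Tensor products: if `ε` acts as `1` on a factor, that factor is one-dimensional and the product is
irreducible. If it acts as `-1` on both, it acts as `1` on the product, so every irreducible
constituent `π` is one-dimensional. The multiplicity of `π` in `ρ ⊗ σ` is the character pairing of
`ρ` with the irreducible `π ⊗ σ*`, hence at most one (`finrank_intertwiningMap_tprod_le_one`).

Self-conjugacy: the character of `ρ^τ` is that of `ρ` composed with `τ`, and `τ x` is `x` or `εx`.
These have equal characters if `ε` acts as `1`, and both vanish if `ε` acts as `-1` and `x` is
noncentral. What remains is that `τ` fixes the centre (`tau_eq_self_of_central`). This dictates the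
choice of `τ`: for odd `n` the element `γ_X` is central with square `(-1)^(n(n-1)/2)`, so inversion
moves it exactly when `n ≡ 3 (mod 4)`. -/

theorem IsIrreducible.of_equiv {ρ : Representation k G V} {σ : Representation k G W}
    [ρ.IsIrreducible] (e : ρ.Equiv σ) : σ.IsIrreducible := by
  rw [irreducible_iff_isSimpleModule_asModule]
  exact IsSimpleModule.congr
    (LinearEquiv.ofBijective (IntertwiningMap.equivLinearMapAsModule σ ρ e.symm.toIntertwiningMap)
      e.symm.toLinearEquiv.bijective)

theorem IsIrreducible.nontrivial (ρ : Representation k G V) [ρ.IsIrreducible] : Nontrivial V := by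
  by_contra hV
  rw [not_nontrivial_iff_subsingleton] at hV
  exact bot_ne_top (α := Subrepresentation ρ)
    (Subrepresentation.toSubmodule_injective (Subsingleton.elim _ _))

/-- An atom of the lattice of subrepresentations is an irreducible representation. -/
theorem _root_.Subrepresentation.isIrreducible_of_isAtom {ρ : Representation k G V}
    {U : Subrepresentation ρ} (hU : IsAtom U) : U.toRepresentation.IsIrreducible := by
  refine @IsSimpleOrder.mk _ _ _ ⟨⊥, ⊤, fun h => hU.1 ?_⟩ fun S => ?_
  · have hd : (⊥ : Submodule k U.toSubmodule) = ⊤ := congrArg Subrepresentation.toSubmodule h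
    apply Subrepresentation.toSubmodule_injective
    refine (Submodule.eq_bot_iff _).mpr fun x hx => ?_
    exact congrArg Subtype.val ((Submodule.eq_bot_iff _).mp hd.symm ⟨x, hx⟩ Submodule.mem_top)
  · let T : Subrepresentation ρ :=
      { toSubmodule := S.toSubmodule.map U.toSubmodule.subtype
        apply_mem_toSubmodule := by
          rintro g _ ⟨x, hx, rfl⟩
          exact ⟨_, S.apply_mem_toSubmodule g hx, rfl⟩ }
    have hTU : T ≤ U := Submodule.map_subtype_le U.toSubmodule S.toSubmodule
    have hinj := Submodule.map_injective_of_injective U.toSubmodule.injective_subtype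
    rcases hU.le_iff.mp hTU with h | h
    · left
      apply Subrepresentation.toSubmodule_injective
      apply hinj
      exact (congrArg Subrepresentation.toSubmodule h).trans (Submodule.map_bot _).symm
    · right
      apply Subrepresentation.toSubmodule_injective
      apply hinj
      exact (congrArg Subrepresentation.toSubmodule h).trans
        (Submodule.map_subtype_top U.toSubmodule).symm

/-- The dual of an irreducible finite-dimensional representation is irreducible. -/
theorem IsIrreducible.dual [FiniteDimensional k V] (ρ : Representation k G V) [ρ.IsIrreducible] :
    ρ.dual.IsIrreducible where
  exists_pair_ne := by
    refine ⟨⊥, ⊤, fun h => ?_⟩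
    have hd : (⊥ : Submodule k (Module.Dual k V)) = ⊤ :=
      congrArg Subrepresentation.toSubmodule h
    have := IsIrreducible.nontrivial ρ
    exact bot_ne_top hd
  eq_bot_or_eq_top U := by
    -- The common kernel of the functionals in `U`; in finite dimension its annihilator gives `U`
    -- back.
    let C : Subrepresentation ρ :=
      { toSubmodule := U.toSubmodule.dualCoannihilator
        apply_mem_toSubmodule := fun g v hv => by
          rw [Submodule.mem_dualCoannihilator] at hv ⊢
          intro φ hφ
          have h := hv _ (U.apply_mem_toSubmodule g⁻¹ hφ)
          simpa [Module.Dual.transpose_apply] using h }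
    have hC : C.toSubmodule.dualAnnihilator = U.toSubmodule :=
      Subspace.dualCoannihilator_dualAnnihilator_eq
    rcases eq_bot_or_eq_top C with h | h
    · right
      apply Subrepresentation.toSubmodule_injective
      rw [← hC, h]
      exact Submodule.dualAnnihilator_bot
    · left
      apply Subrepresentation.toSubmodule_injective
      rw [← hC, h]
      exact Submodule.dualAnnihilator_top

/-- Tensoring an irreducible representation with a one-dimensional one keeps it irreducible. -/
theorem IsIrreducible.tprod_of_finrank_eq_one (ρ : Representation k G V) (σ : Representation k G W)
    [σ.IsIrreducible] (h : Module.finrank k V = 1) : (ρ.tprod σ).IsIrreducible := by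
  obtain ⟨v, hv, hspan⟩ := finrank_eq_one_iff'.mp h
  -- A linear bijection that intertwines only up to scalars, which suffices to match invariant
  -- subspaces.
  let f : W →ₗ[k] TensorProduct k V W := TensorProduct.mk k V W v
  have hf : Function.Surjective f := by
    intro t
    induction t using TensorProduct.induction_on with
    | zero => exact ⟨0, map_zero f⟩
    | tmul x w =>
      obtain ⟨c, rfl⟩ := hspan x
      exact ⟨c • w, by simp [f, TensorProduct.smul_tmul]⟩
    | add a b ha hb =>
      obtain ⟨a, rfl⟩ := ha
      obtain ⟨b, rfl⟩ := hb
      exact ⟨a + b, map_add f a b⟩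
  have hinj : Function.Injective f := by
    obtain ⟨φ, hφ⟩ : ∃ φ : Module.Dual k V, φ v ≠ 0 := by
      by_contra! hφ
      exact hv ((Module.forall_dual_apply_eq_zero_iff k v).mp hφ)
    rw [injective_iff_map_eq_zero]
    intro w hw
    have := congrArg ((_root_.TensorProduct.lid k W).toLinearMap ∘ₗ φ.rTensor W) hw
    simpa [f, hφ] using this
  have hscal (g : G) : ∃ c : k, ρ g v = c • v := (hspan (ρ g v)).imp fun _ hc => hc.symm
  refine @IsSimpleOrder.mk _ _ _ ⟨⊥, ⊤, fun hbt => ?_⟩ fun U => ?_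
  · have hd : (⊥ : Submodule k (TensorProduct k V W)) = ⊤ :=
      congrArg Subrepresentation.toSubmodule hbt
    apply bot_ne_top (α := Subrepresentation σ)
    apply Subrepresentation.toSubmodule_injective
    refine (Submodule.eq_bot_iff _).mpr (fun w _ => ?_) |>.symm
    apply hinj
    rw [map_zero]
    exact (Submodule.eq_bot_iff _).mp hd.symm _ Submodule.mem_top
  · let C : Subrepresentation σ :=
      { toSubmodule := U.toSubmodule.comap f
        apply_mem_toSubmodule := fun g w hw => by
          -- With the scalar of `g⁻¹` rather than of `g`, no scalar has to be inverted.
          obtain ⟨c, hc⟩ := hscal g⁻¹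
          have h1 : v ⊗ₜ[k] σ g w = c • (ρ.tprod σ) g (f w) := by
            have : ρ g (ρ g⁻¹ v) = v := by simp
            rw [hc, map_smul] at this
            simp only [f, tprod_apply, TensorProduct.mk_apply, TensorProduct.map_tmul]
            rw [TensorProduct.smul_tmul', this]
          change v ⊗ₜ[k] σ g w ∈ U.toSubmodule
          rw [h1]
          exact U.toSubmodule.smul_mem _ (U.apply_mem_toSubmodule g hw) }
    have hC : C.toSubmodule.map f = U.toSubmodule := Submodule.map_comap_eq_of_surjective hf _
    rcases eq_bot_or_eq_top C with h | h
    · left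
      apply Subrepresentation.toSubmodule_injective
      rw [← hC, h]
      exact Submodule.map_bot f
    · right
      apply Subrepresentation.toSubmodule_injective
      rw [← hC, h]
      exact (Submodule.map_top f).trans (LinearMap.range_eq_top.mpr hf)

end Field

/-! ### Schur's lemma and character orthogonality. -/

section AlgClosed

variable {k G V W E : Type*} [Field k] [IsAlgClosed k] [Group G]
  [AddCommGroup V] [Module k V] [FiniteDimensional k V]
  [AddCommGroup W] [Module k W] [FiniteDimensional k W]
  [AddCommGroup E] [Module k E] [FiniteDimensional k E]

/-- An operator commuting with an irreducible representation is a scalar. -/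
theorem IsIrreducible.exists_smul_of_commute (ρ : Representation k G V) [ρ.IsIrreducible]
    (T : V →ₗ[k] V) (hT : ∀ g, T ∘ₗ ρ g = ρ g ∘ₗ T) : ∃ c : k, ∀ v, T v = c • v := by
  obtain ⟨c, hc⟩ := (IsIrreducible.algebraMap_intertwiningMap_bijective_of_isAlgClosed
    (ρ := ρ)).2 ⟨T, hT⟩
  exact ⟨c, fun v => by simpa using (DFunLike.congr_fun hc v).symm⟩

/-- An irreducible representation with commuting operators is one-dimensional. -/
theorem IsIrreducible.finrank_eq_one_of_commute (ρ : Representation k G V) [ρ.IsIrreducible]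
    (h : ∀ g g', ρ g ∘ₗ ρ g' = ρ g' ∘ₗ ρ g) : Module.finrank k V = 1 := by
  have := IsIrreducible.nontrivial ρ
  obtain ⟨v, hv⟩ := exists_ne (0 : V)
  let L : Subrepresentation ρ :=
    { toSubmodule := Submodule.span k {v}
      apply_mem_toSubmodule := fun g w hw => by
        obtain ⟨c, hc⟩ := IsIrreducible.exists_smul_of_commute ρ (ρ g) (h g)
        rw [hc]
        exact Submodule.smul_mem _ _ hw }
  refine finrank_eq_one v hv fun w => ?_
  rcases eq_bot_or_eq_top L with hL | hL
  · have : Submodule.span k {v} = ⊥ := congrArg Subrepresentation.toSubmodule hL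
    exact absurd (Submodule.span_singleton_eq_bot.mp this) hv
  · have : Submodule.span k {v} = ⊤ := congrArg Subrepresentation.toSubmodule hL
    exact Submodule.mem_span_singleton.mp (this ▸ Submodule.mem_top)

variable [Finite G] [CharZero k]

/-- A one-dimensional representation occurs at most once in a tensor product of two irreducible
representations. -/
theorem finrank_intertwiningMap_tprod_le_one (π : Representation k G E)
    (ρ : Representation k G V) (σ : Representation k G W) [ρ.IsIrreducible] [σ.IsIrreducible]
    (h : Module.finrank k E = 1) : Module.finrank k (IntertwiningMap π (ρ.tprod σ)) ≤ 1 := by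
  classical
  have := Fintype.ofFinite G
  have hG : (Nat.card G : k) ≠ 0 := Nat.cast_ne_zero.mpr Nat.card_pos.ne'
  let _ := invertibleOfNonzero hG
  have := IsIrreducible.dual σ
  have := IsIrreducible.tprod_of_finrank_eq_one π σ.dual h
  have h1 := card_inv_mul_sum_char_mul_char_eq_finrank π (ρ.tprod σ)
  have h2 := char_orthonormal ρ (π.tprod σ.dual)
  -- Dualising twice moves `σ` across the pairing: `⟨ρ, π ⊗ σ*⟩ = ⟨ρ ⊗ σ, π⟩`.
  have h3 : ∀ g : G, ρ.character g * (π.tprod σ.dual).character g⁻¹ =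
      (ρ.tprod σ).character g * π.character g⁻¹ := by
    intro g
    simp only [char_tensor, Pi.mul_apply, char_dual, inv_inv]
    ring
  simp_rw [h3] at h2
  rw [h1] at h2
  split_ifs at h2
  · exact (Nat.cast_injective (R := k) (by simpa using h2)).le
  · have : Module.finrank k (IntertwiningMap π (ρ.tprod σ)) = 0 :=
      Nat.cast_injective (R := k) (by simpa using h2)
    omega

/-- An irreducible representation is equivalent to every representation with the same character. -/
theorem IsIrreducible.nonempty_equiv_of_character_eq (π : Representation k G E)
    (ρ : Representation k G V) [ρ.IsIrreducible] (h : π.character = ρ.character) :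
    Nonempty (π.Equiv ρ) := by
  have := Fintype.ofFinite G
  have hG : (Nat.card G : k) ≠ 0 := Nat.cast_ne_zero.mpr Nat.card_pos.ne'
  let _ := invertibleOfNonzero hG
  have hdim : Module.finrank k E = Module.finrank k V :=
    Nat.cast_injective (R := k) (by rw [← char_one π, ← char_one ρ, h])
  -- Equal characters give `dim Hom(π, ρ) = dim Hom(ρ, ρ) = 1`. A nonzero intertwiner is onto by
  -- irreducibility, and bijective because the values at `1` make the dimensions equal.
  have h1 := card_inv_mul_sum_char_mul_char_eq_finrank π ρ
  rw [h, card_inv_mul_sum_char_mul_char_eq_finrank ρ ρ, IsIrreducible.finrank_intertwiningMap_self]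
    at h1
  have h2 : Module.finrank k (IntertwiningMap π ρ) = 1 :=
    (Nat.cast_injective (R := k) h1).symm
  have := Module.nontrivial_of_finrank_pos (h2 ▸ one_pos)
  obtain ⟨f, hf⟩ := exists_ne (0 : IntertwiningMap π ρ)
  have hs : Function.Surjective f := (IsIrreducible.surjective_or_eq_zero f).resolve_right hf
  have hi : Function.Injective f :=
    (LinearMap.injective_iff_surjective_of_finrank_eq_finrank hdim (f := f.toLinearMap)).mpr hs
  exact ⟨f.ofBijective ⟨hi, hs⟩⟩

end AlgClosed

end Representation

open Representation

/-! ## Criteria for multiplicity-freeness -/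

namespace IsMultiplicityFree

variable {G V : Type*} [Group G] [Finite G] [AddCommGroup V] [Module ℂ V] [FiniteDimensional ℂ V]
  {ρ : Representation ℂ G V}

/-- A representation of a finite group is multiplicity-free if equivalent irreducible
subrepresentations are equal. -/
theorem of_unique (h : ∀ U₁ U₂ : Subrepresentation ρ, U₁.toRepresentation.IsIrreducible →
    U₂.toRepresentation.IsIrreducible →
    Nonempty (U₁.toRepresentation.Equiv U₂.toRepresentation) → U₁ = U₂) :
    IsMultiplicityFree ρ := by
  -- The hypothesis of Maschke's theorem, which makes the module semisimple.
  have : NeZero (Nat.card G : ℂ) := ⟨Nat.cast_ne_zero.mpr Nat.card_pos.ne'⟩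
  obtain ⟨s, hind, hsup, hs⟩ :=
    IsSemisimpleModule.exists_sSupIndep_sSup_simples_eq_top (MonoidAlgebra ℂ G) ρ.asModule
  have : IsNoetherian (MonoidAlgebra ℂ G) ρ.asModule :=
    isNoetherian_of_tower ℂ (inferInstanceAs (IsNoetherian ℂ V))
  have hfin : s.Finite := WellFoundedGT.finite_of_sSupIndep hind
  have := hfin.to_subtype
  let e := (Finite.equivFin s).symm
  let U (i : Fin (Nat.card s)) : Subrepresentation ρ := Subrepresentation.ofSubmodule' (e i).1
  have hU (i) : (U i).toRepresentation.IsIrreducible := by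
    have := hs (e i) (e i).2
    exact Subrepresentation.isIrreducible_of_isAtom
      ((Subrepresentation.subrepresentationSubmoduleOrderIso.symm.isAtom_iff _).mpr
        (isSimpleModule_iff_isAtom.mp this))
  refine ⟨Nat.card s, U, ?_, hU, fun i j hij => ⟨fun φ => hij ?_⟩⟩
  · have hind' : iSupIndep fun i => (e i).1 := ((sSupIndep_iff (s := s)).mp hind).comp e.injective
    have hsup' : ⨆ i, (e i).1 = ⊤ := by
      rw [e.iSup_comp (g := fun x : s => x.1), ← sSup_eq_iSup', hsup]
    exact (DirectSum.isInternal_submodule_iff_iSupIndep_and_iSup_eq_top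
      (fun i => (e i).1)).mpr ⟨hind', hsup'⟩
  · have hij := h _ _ (hU i) (hU j) ⟨φ⟩
    exact e.injective (Subtype.ext
      (Subrepresentation.subrepresentationSubmoduleOrderIso.symm.injective hij))

theorem of_isIrreducible [ρ.IsIrreducible] : IsMultiplicityFree ρ := by
  have key (U : Subrepresentation ρ) (hU : U.toRepresentation.IsIrreducible) : U = ⊤ := by
    refine (eq_bot_or_eq_top U).resolve_left ?_
    rintro rfl
    exact not_subsingleton_iff_nontrivial.mpr
      (IsIrreducible.nontrivial (⊥ : Subrepresentation ρ).toRepresentation)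
      (inferInstanceAs (Subsingleton (⊥ : Submodule ℂ V)))
  exact of_unique fun U₁ U₂ h₁ h₂ _ => (key U₁ h₁).trans (key U₂ h₂).symm

/-- A representation is multiplicity-free if the intertwining spaces from its irreducible
subrepresentations into it are at most one-dimensional. -/
theorem of_finrank_intertwiningMap_le_one
    (h : ∀ U : Subrepresentation ρ, U.toRepresentation.IsIrreducible →
      Module.finrank ℂ (IntertwiningMap U.toRepresentation ρ) ≤ 1) : IsMultiplicityFree ρ := by
  have key (U₁ U₂ : Subrepresentation ρ) (h₁ : U₁.toRepresentation.IsIrreducible)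
      (e : U₁.toRepresentation.Equiv U₂.toRepresentation) : U₂ ≤ U₁ := by
    let incl (U : Subrepresentation ρ) : IntertwiningMap U.toRepresentation ρ :=
      ⟨U.toSubmodule.subtype, fun _ => rfl⟩
    have hne : incl U₁ ≠ 0 := by
      intro h0
      exact not_subsingleton_iff_nontrivial.mpr (IsIrreducible.nontrivial U₁.toRepresentation)
        (subsingleton_of_forall_eq 0 fun x => Subtype.ext (DFunLike.congr_fun h0 x))
    have : Module.Finite ℂ (IntertwiningMap U₁.toRepresentation ρ) :=
      Module.Finite.of_injective (IntertwiningMap.toLinearMapl (ρ := U₁.toRepresentation) (σ := ρ))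
        (IntertwiningMap.toLinearMap_injective _ _)
    -- The inclusion of `U₁` and its embedding through `U₂` are multiples of one map `f`, so the
    -- image of the second lies in `U₁`.
    obtain ⟨f, hf⟩ := finrank_le_one_iff.mp (h U₁ h₁)
    obtain ⟨c, hc⟩ := hf (incl U₁)
    obtain ⟨d, hd⟩ := hf ((incl U₂).comp e.toIntertwiningMap)
    have hc0 : c ≠ 0 := by
      rintro rfl
      exact hne (by rw [← hc, zero_smul])
    intro x hx
    have hx' : x = ((incl U₂).comp e.toIntertwiningMap) (e.symm ⟨x, hx⟩) := by
      rw [IntertwiningMap.comp_apply, Representation.Equiv.coe_toIntertwiningMap,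
        Representation.Equiv.apply_symm_apply]
      rfl
    have hmul : (incl U₂).comp e.toIntertwiningMap = (d * c⁻¹) • incl U₁ := by
      rw [← hd, ← hc, smul_smul, mul_assoc, inv_mul_cancel₀ hc0, mul_one]
    rw [hx', hmul]
    exact U₁.toSubmodule.smul_mem _ (Subtype.property _)
  exact of_unique fun U₁ U₂ h₁ h₂ ⟨e⟩ => le_antisymm (key U₂ U₁ h₂ e.symm) (key U₁ U₂ h₁ e)

end IsMultiplicityFree

theorem character_tauConjugate {G V : Type*} [Group G] (τ : InvolutiveAntiAut G) [AddCommGroup V]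
    [Module ℂ V] [FiniteDimensional ℂ V] (ρ : Representation ℂ G V) (g : G) :
    (tauConjugate τ ρ).character g = ρ.character (τ g) :=
  LinearMap.trace_transpose' (ρ (τ g))

/-! ## Representations of the Clifford groups -/

namespace CliffordGroup

variable {n : ℕ}

/-- The central element `ε` of `CL(n)`. -/
def eps (n : ℕ) : CliffordGroup n := ⟨-1, ∅⟩

theorem eps_mul (x : CliffordGroup n) : eps n * x = ⟨-x.sign, x.supp⟩ := by
  simp [eps, mul_def, xi, empty_symmDiff']

theorem eps_mul_eps : eps n * eps n = 1 := by
  rw [eps_mul]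
  simp [eps, one_def]

theorem eps_mul_comm (x : CliffordGroup n) : eps n * x = x * eps n := by
  rw [eps_mul]
  simp [eps, mul_def, xi, symmDiff_empty']

theorem eq_or_eq_eps_mul {x y : CliffordGroup n} (h : x.supp = y.supp) :
    x = y ∨ x = eps n * y := by
  rw [eps_mul]
  rcases Int.units_eq_one_or x.sign with hx | hx <;>
    rcases Int.units_eq_one_or y.sign with hy | hy <;>
    simp [CliffordGroup.ext_iff, h, hx, hy]

/-- Symmetric difference is commutative, so only the sign can depend on the order of the factors. -/
theorem mul_comm_or (x y : CliffordGroup n) : x * y = y * x ∨ x * y = eps n * (y * x) :=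
  eq_or_eq_eps_mul (symmDiff_comm _ _)

theorem supp_tau (x : CliffordGroup n) : (tau n x).supp = x.supp := by
  unfold tau
  split_ifs <;> rfl

/-- Each element of `A` other than `i` lies on exactly one side of `i`. The parity of this count
decides whether `γ_i` and `γ_A` commute. -/
theorem xi_singleton_add_xi_singleton (i : Fin n) (A : Finset (Fin n)) :
    xi {i} A + xi A {i} = (A.erase i).card := by
  simp only [xi_eq_sum, Finset.sum_singleton]
  rw [← Finset.sum_add_distrib, Finset.card_eq_sum_ones, ← Finset.filter_ne' A i,
    Finset.sum_filter]
  refine Finset.sum_congr rfl fun a _ => ?_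
  rcases lt_trichotomy a i with h | h | h
  · simp [h, h.ne, h.not_gt]
  · simp [h]
  · simp [h, h.ne', h.not_gt]

theorem even_card_erase_of_central {x : CliffordGroup n} (hx : ∀ y, x * y = y * x) (i : Fin n) :
    Even (x.supp.erase i).card := by
  have h := congrArg CliffordGroup.sign (hx ⟨1, {i}⟩)
  simp only [mul_def, mul_one, one_mul, mul_right_inj] at h
  rw [← xi_singleton_add_xi_singleton, ← neg_one_pow_eq_one_iff_even (R := ℤˣ) (by decide),
    pow_add, h]
  exact Int.units_mul_self _

/-- `τ` fixes the centre of `CL(n)`. -/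
theorem tau_eq_self_of_central {x : CliffordGroup n} (hx : ∀ y, x * y = y * x) :
    tau n x = x := by
  -- If `A` is nonempty, erasing a member shows that `|A|` is odd, while erasing a nonmember would
  -- show that it is even; hence `A = X`.
  have hA : x.supp = ∅ ∨ (x.supp.card = n ∧ Odd n) := by
    rcases x.supp.eq_empty_or_nonempty with h | ⟨a, ha⟩
    · exact Or.inl h
    right
    have hodd : Odd x.supp.card := by
      rw [← Finset.card_erase_add_one ha]
      exact (even_card_erase_of_central hx a).add_one
    have huniv : x.supp = Finset.univ := by
      refine Finset.eq_univ_of_forall fun i => ?_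
      by_contra hi
      have := even_card_erase_of_central hx i
      rw [Finset.erase_eq_of_notMem hi] at this
      exact (Nat.not_even_iff_odd.mpr hodd) this
    have hcard : x.supp.card = n := by rw [huniv, Finset.card_univ, Fintype.card_fin]
    exact ⟨hcard, hcard ▸ hodd⟩
  suffices h : (tau n x).sign = x.sign from CliffordGroup.ext h (supp_tau x)
  unfold tau
  split_ifs with h3
  · change x.sign * (-1) ^ (x.supp.card * (x.supp.card + 1) / 2) = x.sign
    rcases hA with h | ⟨h, -⟩
    · simp [h]
    · obtain ⟨q, rfl⟩ : ∃ q, n = 4 * q + 3 := ⟨n / 4, by omega⟩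
      have : (4 * q + 3) * (4 * q + 3 + 1) / 2 = 2 * ((4 * q + 3) * (q + 1)) :=
        Nat.div_eq_of_eq_mul_left two_pos (by ring)
      rw [h, this, pow_mul]
      simp
  · change x.sign * (-1) ^ xi x.supp x.supp = x.sign
    rw [xi_self]
    rcases hA with h | ⟨h, hodd⟩
    · simp [h]
    · obtain ⟨q, rfl⟩ : ∃ q, n = 4 * q + 1 := ⟨n / 4, by obtain ⟨r, hr⟩ := hodd; omega⟩
      have : (4 * q + 1) * (4 * q + 1 - 1) / 2 = 2 * ((4 * q + 1) * q) :=
        Nat.div_eq_of_eq_mul_left two_pos (by rw [Nat.add_sub_cancel]; ring)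
      rw [h, this, pow_mul]
      simp

variable {V : Type*} [AddCommGroup V] [Module ℂ V]

theorem finrank_eq_one_of_eps [FiniteDimensional ℂ V] (ρ : Representation ℂ (CliffordGroup n) V)
    [ρ.IsIrreducible] (h : ρ (eps n) = 1) : Module.finrank ℂ V = 1 := by
  refine IsIrreducible.finrank_eq_one_of_commute ρ fun x y => ?_
  rw [← Module.End.mul_eq_comp, ← Module.End.mul_eq_comp, ← _root_.map_mul, ← _root_.map_mul]
  rcases mul_comm_or x y with hxy | hxy
  · rw [hxy]
  · rw [hxy, _root_.map_mul, h, one_mul]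

/-- In an irreducible representation, `ε` acts as `1` or `-1`. -/
theorem map_eps [FiniteDimensional ℂ V] (ρ : Representation ℂ (CliffordGroup n) V)
    [ρ.IsIrreducible] : ρ (eps n) = 1 ∨ ρ (eps n) = -1 := by
  obtain ⟨c, hc⟩ := IsIrreducible.exists_smul_of_commute ρ (ρ (eps n)) fun g => by
    rw [← Module.End.mul_eq_comp, ← Module.End.mul_eq_comp, ← _root_.map_mul, ← _root_.map_mul,
      eps_mul_comm]
  have h2 (v : V) : (c * c - 1) • v = 0 := by
    rw [sub_smul, mul_smul, ← hc, ← hc, ← Module.End.mul_apply, ← _root_.map_mul, eps_mul_eps]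
    simp
  by_cases hcc : c * c - 1 = 0
  · rcases mul_self_eq_one_iff.mp (sub_eq_zero.mp hcc) with rfl | rfl
    · left; ext v; simp [hc]
    · right; ext v; simp [hc]
  -- If `c² ≠ 1` then every vector is zero, so either alternative holds.
  · left
    ext v
    rw [(smul_eq_zero.mp (h2 v)).resolve_left hcc, map_zero, map_zero]

theorem character_eps_mul_of_eps_eq_neg_one {ρ : Representation ℂ (CliffordGroup n) V}
    (h : ρ (eps n) = -1) (x : CliffordGroup n) :
    ρ.character (eps n * x) = -ρ.character x := by
  simp [character, h]

/-- Representations on which `ε` acts as `-1` have characters supported on the centre. -/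
theorem character_eq_zero_of_not_central {ρ : Representation ℂ (CliffordGroup n) V}
    (h : ρ (eps n) = -1) {x : CliffordGroup n} (hx : ¬ ∀ y, x * y = y * x) :
    ρ.character x = 0 := by
  push Not at hx
  obtain ⟨y, hy⟩ := hx
  have hxy := (mul_comm_or y x).resolve_left hy.symm
  -- As a class function the character agrees at `x` and `εx`, yet `ε` acting as `-1` makes these
  -- values opposite.
  have h1 : y * x * y⁻¹ = eps n * x := by rw [hxy, mul_assoc, mul_inv_cancel_right]
  have h2 := char_conj ρ x y
  rw [h1, character_eps_mul_of_eps_eq_neg_one h] at h2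
  exact self_eq_neg.mp h2.symm

theorem character_tau [FiniteDimensional ℂ V] (ρ : Representation ℂ (CliffordGroup n) V)
    [ρ.IsIrreducible] (x : CliffordGroup n) : ρ.character (tau n x) = ρ.character x := by
  have hor := eq_or_eq_eps_mul (supp_tau x)
  rcases map_eps ρ with h | h
  · rcases hor with hx | hx
    · rw [hx]
    · rw [hx, character, _root_.map_mul, h, one_mul, character]
  · by_cases hx : ∀ y, x * y = y * x
    · rw [tau_eq_self_of_central hx]
    · rcases hor with ht | ht
      · rw [ht]
      · rw [ht, character_eps_mul_of_eps_eq_neg_one h, character_eq_zero_of_not_central h hx,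
          neg_zero]

theorem isMultiplicityFree_tprod {W : Type*} [AddCommGroup W] [Module ℂ W]
    [FiniteDimensional ℂ V] [FiniteDimensional ℂ W] (ρ : Representation ℂ (CliffordGroup n) V)
    (σ : Representation ℂ (CliffordGroup n) W) [ρ.IsIrreducible] [σ.IsIrreducible] :
    IsMultiplicityFree (ρ.tprod σ) := by
  rcases map_eps ρ with hρ | hρ
  · have := IsIrreducible.tprod_of_finrank_eq_one ρ σ (finrank_eq_one_of_eps ρ hρ)
    exact .of_isIrreducible
  rcases map_eps σ with hσ | hσ
  · have := IsIrreducible.tprod_of_finrank_eq_one σ ρ (finrank_eq_one_of_eps σ hσ)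
    have := IsIrreducible.of_equiv (Representation.TensorProduct.comm σ ρ)
    exact .of_isIrreducible
  have hM : (ρ.tprod σ) (eps n) = 1 := by
    rw [Representation.tprod_apply, hρ, hσ]
    ext v w
    simp [_root_.TensorProduct.neg_tmul, _root_.TensorProduct.tmul_neg]
  refine .of_finrank_intertwiningMap_le_one fun U hU => ?_
  -- `U` inherits the trivial action of `ε`, hence is one-dimensional.
  refine finrank_intertwiningMap_tprod_le_one U.toRepresentation ρ σ ?_
  refine finrank_eq_one_of_eps U.toRepresentation ?_
  ext v
  exact congrArg (fun f => f v.1) hM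

end CliffordGroup

theorem theorem7p1 (n : ℕ) (hn : 1 ≤ n) :
    IsTauSimplyReducible.{u} (CliffordGroup n) (CliffordGroup.tau n) := by
  refine ⟨fun V W _ _ _ _ _ _ ρ σ hρ hσ => CliffordGroup.isMultiplicityFree_tprod ρ σ,
    fun V _ _ _ ρ hρ => IsIrreducible.nonempty_equiv_of_character_eq _ ρ ?_⟩
  ext x
  rw [character_tauConjugate, CliffordGroup.character_tau]
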